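/- Let $\mathcal{M}$ be a simple oriented matroid (no loops, no parallel or antiparallel elements) on a finite ground set $E$, with set of topes (maximal covectors) $\mathcal{T}$, and suppose that $\mathcal{M}$ is not acyclic, i.e. the all-positive sign vector is not a covector. For a sign vector $F$ let $F^+$ and $F^-$ denote its positive and negative parts. A subset $A\subseteq E$ is acyclic if some covector is positive on all of $A$; for an acyclic set $A$, $\mathrm{conv}(A)$ is the set of all $b\in E$ such that $F(b)=+$ for every covector $F$ that is positive on all of $A$; for a non-acyclic set $H$ put $\mathrm{conv}(H)=E$. A set $A$ is convex if it is acyclic and $\mathrm{conv}(A)=A$, and a convex set $A$ is free if $a\notin\mathrm{conv}(A\setminus\{a\})$ for every $a\in A$. Let $\widehat L$ be the poset of convex subsets of $E$ ordered by inclusion, with least element $\hat 0=\emptyset$, augmented by the greatest element $\hat 1=E$. For a bounded poset $P$ let $P^{\mathrm c}$ be its set of coatoms (empty if $P$ is a singleton; $\{x\}$ if $P$ is a two-element chain $x<y$). For $A\subseteq E$ let $\mathcal{T}_A^+=\{T\in\mathcal{T}: T(a)=+\text{ for all }a\in A\}$. Let $\boldsymbol\Gamma$ be the graph with vertex set $\mathcal{T}$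 in which distinct $T',T''$ are adjacent iff $(T')^+\cup(T'')^+=E$. Let $\mathbf{max}^+(\mathcal{T})$ be the set of topes whose positive parts are maximal with respect to inclusion, and let $\boldsymbol\Gamma_{\mathbf{max}}^+$ be the subgraph of $\boldsymbol\Gamma$ induced on $\mathbf{max}^+(\mathcal{T})$. The cyclomatic number of a finite graph is its number of edges minus its number of vertices plus its number of connected components. Then: 1. The graph $\boldsymbol\Gamma_{\mathbf{max}}^+$ is connected; every tope not in $\mathbf{max}^+(\mathcal{T})$ is adjacent in $\boldsymbol\Gamma$ to some tope in $\mathbf{max}^+(\mathcal{T})$; and the graph $\boldsymbol\Gamma$ is connected. 2. The cyclomatic number of $\boldsymbol\Gamma$ equals $$1+\binom{|\mathcal{T}|}{2}+\sum_{\substack{A\in\widehat L-\{\hat 0,\hat 1\}\\ A\text{ free}}}(-1)^{|A|}\binom{1+|\mathcal{T}_A^+|}{2}.$$ 3. For every $T\in\mathbf{max}^+(\mathcal{T})$ the set $T^-$ belongs to $\widehat L$, and the degree of $T$ in $\boldsymbol\Gamma_{\mathbf{max}}^+$ is the number $|[T^-,\hat 1]^{\mathrm c}|$ of coatoms of the interval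 $[T^-,\hat 1]$ of $\widehat L$. The number of edges of $\boldsymbol\Gamma_{\mathbf{max}}^+$ is $$\frac12\sum_{D\in\widehat L:\ E-D\in\widehat L^{\mathrm c}}\bigl|[D,\hat 1]^{\mathrm c}\bigr|,$$ and the cyclomatic number of $\boldsymbol\Gamma_{\mathbf{max}}^+$ is $$1+\frac12\sum_{D\in\widehat L:\ E-D\in\widehat L^{\mathrm c}}\bigl|[D,\hat 1]^{\mathrm c}\bigr|-\bigl|\widehat L^{\mathrm c}\bigr|.$$ -/

import Mathlib

/-- The composition `X ∘ Y` of two sign vectors. -/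
def signComp {E : Type*} (X Y : E → SignType) (e : E) : SignType :=
  if X e = 0 then Y e else X e

/-- The separation set `S(X, Y)` of two sign vectors. -/
def signSep {E : Type*} (X Y : E → SignType) : Set E :=
  {e | X e ≠ 0 ∧ X e = -Y e}

/-- An oriented matroid on the ground set `E` (finite in all uses), given by its covectors
subject to the covector axioms. -/
structure OrientedMatroid (E : Type*) where
  covectors : Set (E → SignType)
  zero_mem : (fun _ => 0) ∈ covectors
  neg_mem : ∀ X ∈ covectors, (fun e => -X e) ∈ covectors
  comp_mem : ∀ X ∈ covectors, ∀ Y ∈ covectors, signComp X Y ∈ covectors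
  elim : ∀ X ∈ covectors, ∀ Y ∈ covectors, ∀ e ∈ signSep X Y,
    ∃ Z ∈ covectors, Z e = 0 ∧ ∀ f, f ∉ signSep X Y → Z f = signComp X Y f

/-- The positive part of a sign vector. -/
def signPos {E : Type*} (X : E → SignType) : Set E := {e | X e = 1}

/-- The negative part of a sign vector. -/
def signNeg {E : Type*} (X : E → SignType) : Set E := {e | X e = -1}

/-- The cyclomatic number of a finite graph: edges minus vertices plus connected components. -/
noncomputable def cyclomaticNumber {V : Type*} (G : SimpleGraph V) : ℤ :=
  (G.edgeSet.ncard : ℤ) - (Nat.card V : ℤ) + (Nat.card G.ConnectedComponent : ℤ)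

/-- The set of coatoms of the interval `[x, z]` of a poset: the elements of the interval that
are covered by its greatest element `z`. -/
def intervalCoatoms {P : Type*} [PartialOrder P] (x z : P) : Set P :=
  {y | y ∈ Set.Icc x z ∧ y ⋖ z}

namespace OrientedMatroid

variable {E : Type*} (M : OrientedMatroid E)

/-- The restriction of an oriented matroid to a subset `A` of its ground set. -/
def restrict (A : Set E) : OrientedMatroid A where
  covectors := {Y | ∃ X ∈ M.covectors, Y = fun a : A => X a}
  zero_mem := ⟨_, M.zero_mem, rfl⟩
  neg_mem := by
    rintro _ ⟨X, hX, rfl⟩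
    exact ⟨_, M.neg_mem X hX, rfl⟩
  comp_mem := by
    rintro _ ⟨X, hX, rfl⟩ _ ⟨Y, hY, rfl⟩
    exact ⟨_, M.comp_mem X hX Y hY, rfl⟩
  elim := by
    rintro _ ⟨X, hX, rfl⟩ _ ⟨Y, hY, rfl⟩ e he
    obtain ⟨Z, hZ, h0, h⟩ := M.elim X hX Y hY e he
    exact ⟨_, ⟨Z, hZ, rfl⟩, h0, fun f hf => h f hf⟩

/-- The topes: covectors that are maximal for the order on sign vectors induced by
`0 < +`, `0 < -` on each component. -/
def topes : Set (E → SignType) :=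
  {T | T ∈ M.covectors ∧ ∀ Y ∈ M.covectors, (∀ e, T e ≠ 0 → Y e = T e) → Y = T}

/-- `M` is acyclic: the all-positive sign vector is a covector. -/
def IsAcyclic : Prop := (fun _ => 1) ∈ M.covectors

/-- `M` is simple: no loops, no two distinct elements parallel or antiparallel. -/
def IsSimple : Prop :=
  (∀ e, ∃ X ∈ M.covectors, X e ≠ 0) ∧
  ∀ e f, e ≠ f → (∃ X ∈ M.covectors, X e ≠ X f) ∧ (∃ X ∈ M.covectors, X e ≠ -X f)

/-- A subset of the ground set is acyclic if the restriction of `M` to it is acyclic. -/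
def IsAcyclicSet (A : Set E) : Prop := (M.restrict A).IsAcyclic

/-- The convex hull. For a set that is not acyclic the condition on `F` is vacuous and the hull
is the whole ground set, as in the usual convention. -/
def conv (A : Set E) : Set E :=
  {b | ∀ F ∈ M.covectors, (∀ a ∈ A, F a = 1) → F b = 1}

/-- Convex sets are by definition acyclic. -/
def IsConvex (A : Set E) : Prop := M.IsAcyclicSet A ∧ M.conv A = A

/-- The extreme points of a set. -/
def ex (A : Set E) : Set E := {a | a ∈ A ∧ a ∉ M.conv (A \ {a})}

/-- A free set: a convex set all of whose elements are extreme points. -/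
def IsFree (A : Set E) : Prop := M.IsConvex A ∧ M.ex A = A

/-- The lattice of convex sets, ordered by inclusion and augmented by the greatest element `E`. -/
def LHat : Set (Set E) := {A | M.IsConvex A ∨ A = Set.univ}

instance : OrderTop M.LHat where
  top := ⟨Set.univ, Or.inr rfl⟩
  le_top _ := Set.subset_univ _

/-- The free sets other than the least element `∅` and the greatest element `E` of `LHat`. -/
def properFreeSets : Set (Set E) :=
  {A | A ∈ M.LHat ∧ A ≠ ∅ ∧ A ≠ Set.univ ∧ M.IsFree A}

/-- The coatoms of `LHat`. -/
def coatoms : Set M.LHat := {C | IsCoatom C}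

/-- The elements of `LHat` whose complement in the ground set is a coatom of `LHat`. -/
def coatomCompl : Set M.LHat := {D | ∃ C ∈ M.coatoms, (C : Set E) = (D : Set E)ᶜ}

/-- The intersection `T_A^+` of the positive halfspaces of the elements of `A`. -/
def posTopes (A : Set E) : Set (E → SignType) := {T | T ∈ M.topes ∧ ∀ a ∈ A, T a = 1}

/-- The topes whose positive parts are maximal with respect to inclusion. -/
def maxTopes : Set (E → SignType) :=
  {T | T ∈ M.topes ∧ ∀ T' ∈ M.topes, signPos T ⊆ signPos T' → signPos T' = signPos T}

/-- The graph `Γ`: its vertices are the topes, and two (distinct) topes are adjacent if their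
positive parts cover the ground set. -/
def gamma : SimpleGraph M.topes where
  Adj S T := S ≠ T ∧ signPos (S : E → SignType) ∪ signPos (T : E → SignType) = Set.univ
  symm := ⟨fun _ _ h => ⟨h.1.symm, by rw [Set.union_comm]; exact h.2⟩⟩
  loopless := ⟨fun _ h => h.1 rfl⟩

/-- The graph `Γ_max^+`: the subgraph of `Γ` induced by the topes with maximal positive parts. -/
def gammaMax : SimpleGraph {T : M.topes | (T : E → SignType) ∈ M.maxTopes} :=
  M.gamma.induce {T : M.topes | (T : E → SignType) ∈ M.maxTopes}

end OrientedMatroid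

/-!
In a simple oriented matroid the topes are the covectors without zeros, so two topes are adjacent in
`Γ` exactly when no element is negative on both (`gamma_adj_iff_signNeg_subset`). In particular `S`
is adjacent to `-S`.

*Connectedness.* If `S⁺ ⊆ T⁺`, then `-S` is adjacent to both `S` and `T`
(`gamma_reachable_of_signPos_subset`). Topes that differ in a single element are comparable in this
sense, and covector elimination together with simplicity joins any two topes by steps that reduce to
this case (`gamma_reachable`). Sending each tope to a tope with maximal positive part above it is a
retraction of `Γ` onto `Γ_max`, so `Γ_max` is connected as well (`gammaMax_connected`).

*Edges of `Γ`.* Inclusion–exclusion over sets `A` of elements negative on both ends of a pair of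
topes gives the number of edges as `∑ (-1)^|A| C(1 + |T_A⁺|, 2)` over all `A ⊆ E`
(`ncard_edgeSet_gamma_eq_sum`); the terms linear in `|T_A⁺|` sum to zero because no tope is positive.
The number `|T_A⁺|` depends only on the hull of `A` and vanishes when `A` is not acyclic. If the
hull of an acyclic set has a nonextreme point, this point can be added to or removed from the set
without changing the hull (`mem_conv_diff_singleton`), so only free sets contribute
(`sum_not_isFree_eq_zero`).

*The graph `Γ_max`.* The coatoms of the lattice of convex sets are the maximal positive parts of
topes (`range_posPart`), so the neighbours of `T` in `Γ_max` are the coatoms above `T⁻`, and summing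
the degrees counts the edges.
-/

namespace OrientedMatroid

/-! ### Covectors and topes -/

section Topes

variable {E : Type*} {M : OrientedMatroid E}

theorem signComp_of_ne_zero {X Y : E → SignType} {e : E} (h : X e ≠ 0) :
    signComp X Y e = X e := if_neg h

theorem signComp_of_eq_zero {X Y : E → SignType} {e : E} (h : X e = 0) :
    signComp X Y e = Y e := if_pos h

theorem mem_topes_iff (hs : M.IsSimple) {T : E → SignType} :
    T ∈ M.topes ↔ T ∈ M.covectors ∧ ∀ e, T e ≠ 0 := by
  constructor
  · rintro ⟨hT, hmax⟩
    refine ⟨hT, fun e he => ?_⟩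
    obtain ⟨X, hX, hXe⟩ := hs.1 e
    have h := hmax _ (M.comp_mem T hT X hX) fun f hf => signComp_of_ne_zero hf
    rw [← signComp_of_eq_zero (Y := X) he, h] at hXe
    exact hXe he
  · rintro ⟨hT, h0⟩
    exact ⟨hT, fun Y _ h => funext fun e => h e (h0 e)⟩

theorem neg_mem_topes (hs : M.IsSimple) {T : E → SignType} (hT : T ∈ M.topes) :
    (fun e => -T e) ∈ M.topes := by
  rw [mem_topes_iff hs] at hT ⊢
  exact ⟨M.neg_mem T hT.1, fun e he => hT.2 e (by simpa using he)⟩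

theorem signComp_mem_topes (hs : M.IsSimple) {Y T : E → SignType} (hY : Y ∈ M.covectors)
    (hT : T ∈ M.topes) : signComp Y T ∈ M.topes := by
  rw [mem_topes_iff hs] at hT ⊢
  refine ⟨M.comp_mem Y hY T hT.1, fun e => ?_⟩
  by_cases h : Y e = 0
  · rw [signComp_of_eq_zero h]; exact hT.2 e
  · rwa [signComp_of_ne_zero h]

theorem eq_one_or_eq_neg_one_of_mem_topes (hs : M.IsSimple) {T : E → SignType}
    (hT : T ∈ M.topes) (e : E) : T e = 1 ∨ T e = -1 := by
  have h := ((mem_topes_iff hs).1 hT).2 e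
  revert h
  generalize T e = a
  revert a
  decide

theorem eq_neg_one_iff_ne_one_of_mem_topes (hs : M.IsSimple) {T : E → SignType}
    (hT : T ∈ M.topes) (e : E) : T e = -1 ↔ T e ≠ 1 := by
  rcases eq_one_or_eq_neg_one_of_mem_topes hs hT e with h | h <;> rw [h] <;> decide

/-- A tope of a simple oriented matroid is determined by its positive part. -/
theorem eq_of_signPos_eq (hs : M.IsSimple) {S T : E → SignType} (hS : S ∈ M.topes)
    (hT : T ∈ M.topes) (h : signPos S = signPos T) : S = T := by
  funext e
  have he : S e = 1 ↔ T e = 1 := Set.ext_iff.1 h e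
  rcases eq_one_or_eq_neg_one_of_mem_topes hs hT e with hT' | hT'
  · rw [hT', he, hT']
  · rw [hT', eq_neg_one_iff_ne_one_of_mem_topes hs hS, Ne, he, hT']; decide

theorem signNeg_eq_compl_signPos (hs : M.IsSimple) {T : E → SignType} (hT : T ∈ M.topes) :
    signNeg T = (signPos T)ᶜ :=
  Set.ext fun e => eq_neg_one_iff_ne_one_of_mem_topes hs hT e

theorem signPos_neg (T : E → SignType) : signPos (fun e => -T e) = signNeg T := by
  ext e
  change -T e = 1 ↔ T e = -1
  generalize T e = a
  revert a
  decide

theorem signPos_ne_univ (hc : ¬ M.IsAcyclic) {T : E → SignType} (hT : T ∈ M.topes) :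
    signPos T ≠ Set.univ := fun h => hc <| by
  have : T = fun _ => 1 := funext fun e => (h ▸ Set.mem_univ e : e ∈ signPos T)
  exact (this ▸ hT.1 : (fun _ => 1) ∈ M.covectors)

variable [Finite E]

theorem exists_tope_extending {X : E → SignType} (hX : X ∈ M.covectors) :
    ∃ T ∈ M.topes, ∀ e, X e ≠ 0 → T e = X e := by
  obtain ⟨T, ⟨hT, hXT⟩, hmax⟩ := Set.exists_max_image
    {Y | Y ∈ M.covectors ∧ ∀ e, X e ≠ 0 → Y e = X e} (fun Y => {e | Y e ≠ 0}.ncard)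
    (Set.toFinite _) ⟨X, hX, fun _ _ => rfl⟩
  refine ⟨T, ⟨hT, fun Y hY hTY => ?_⟩, hXT⟩
  have hsub : {e | T e ≠ 0} ⊆ {e | Y e ≠ 0} := fun e he => by
    have he' : T e ≠ 0 := he
    rwa [← hTY e he'] at he'
  have heq := Set.eq_of_subset_of_ncard_le hsub
    (hmax Y ⟨hY, fun e he => by rw [hTY e (by rwa [hXT e he]), hXT e he]⟩)
  funext e
  by_cases h : T e = 0
  · have : e ∉ {e | Y e ≠ 0} := heq ▸ fun h' => h' h
    rw [h]
    exact not_not.1 this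
  · exact hTY e h

theorem exists_maxTopes_signPos_subset {T : E → SignType} (hT : T ∈ M.topes) :
    ∃ T' ∈ M.maxTopes, signPos T ⊆ signPos T' := by
  obtain ⟨R, ⟨hR, hTR⟩, hmax⟩ := Set.exists_max_image
    {R | R ∈ M.topes ∧ signPos T ⊆ signPos R} (fun R => (signPos R).ncard)
    (Set.toFinite _) ⟨T, hT, subset_rfl⟩
  exact ⟨R, ⟨hR, fun S hS h =>
    (Set.eq_of_subset_of_ncard_le h (hmax S ⟨hS, hTR.trans h⟩)).symm⟩, hTR⟩

end Topes

/-! ### Convex hulls -/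

section Hull

variable {E : Type*} {M : OrientedMatroid E}

theorem isAcyclicSet_iff {A : Set E} :
    M.IsAcyclicSet A ↔ ∃ G ∈ M.covectors, ∀ a ∈ A, G a = 1 := by
  constructor
  · rintro ⟨G, hG, h⟩
    exact ⟨G, hG, fun a ha => (congrFun h ⟨a, ha⟩).symm⟩
  · rintro ⟨G, hG, h⟩
    exact ⟨G, hG, funext fun a => (h a a.2).symm⟩

theorem not_isAcyclicSet_univ (hc : ¬ M.IsAcyclic) : ¬ M.IsAcyclicSet Set.univ := by
  rw [isAcyclicSet_iff]
  rintro ⟨G, hG, h⟩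
  have : G = fun _ => 1 := funext fun e => h e trivial
  exact hc (this ▸ hG : (fun _ => 1) ∈ M.covectors)

theorem subset_conv (A : Set E) : A ⊆ M.conv A := fun _ ha _ _ h => h _ ha

theorem conv_mono {A B : Set E} (h : A ⊆ B) : M.conv A ⊆ M.conv B :=
  fun _ hb F hF hFB => hb F hF fun a ha => hFB a (h ha)

theorem conv_conv (A : Set E) : M.conv (M.conv A) = M.conv A :=
  Set.Subset.antisymm (fun _ hb F hF hFA => hb F hF fun _ ha => ha F hF hFA) (subset_conv _)

theorem conv_eq_of_subset_of_subset {A B : Set E} (h : A ⊆ B) (h' : B ⊆ M.conv A) :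
    M.conv B = M.conv A :=
  ((conv_mono h').trans (conv_conv A).subset).antisymm (conv_mono h)

theorem conv_empty : M.conv (∅ : Set E) = ∅ :=
  Set.eq_empty_of_forall_notMem fun b hb => by
    have := hb _ M.zero_mem (by simp)
    exact absurd this (by decide)

theorem isAcyclicSet_conv {A : Set E} : M.IsAcyclicSet (M.conv A) ↔ M.IsAcyclicSet A := by
  simp only [isAcyclicSet_iff]
  exact ⟨fun ⟨G, hG, h⟩ => ⟨G, hG, fun a ha => h a (subset_conv A ha)⟩,
    fun ⟨G, hG, h⟩ => ⟨G, hG, fun a ha => ha G hG h⟩⟩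

theorem isConvex_conv {A : Set E} (hA : M.IsAcyclicSet A) : M.IsConvex (M.conv A) :=
  ⟨isAcyclicSet_conv.2 hA, conv_conv A⟩

theorem posTopes_conv (A : Set E) : M.posTopes (M.conv A) = M.posTopes A := by
  ext T
  exact ⟨fun h => ⟨h.1, fun a ha => h.2 a (subset_conv A ha)⟩,
    fun h => ⟨h.1, fun a ha => ha T h.1.1 h.2⟩⟩

theorem isConvex_signPos {T : E → SignType} (hT : T ∈ M.topes) : M.IsConvex (signPos T) :=
  ⟨isAcyclicSet_iff.2 ⟨T, hT.1, fun _ ha => ha⟩,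
    Set.Subset.antisymm (fun _ hb => hb T hT.1 fun _ ha => ha) (subset_conv _)⟩

theorem isFree_empty : M.IsFree (∅ : Set E) :=
  ⟨⟨isAcyclicSet_iff.2 ⟨_, M.zero_mem, by simp⟩, conv_empty⟩, by ext; simp [ex]⟩

/-- If the hull of `A` is free, then `A` is this hull: an extreme point of the hull is missing from
no set with the same hull. -/
theorem eq_conv_of_isFree_conv {A : Set E} (h : M.IsFree (M.conv A)) : A = M.conv A := by
  refine (subset_conv A).antisymm fun e he => ?_
  by_contra heA
  have hex : e ∈ M.ex (M.conv A) := h.2.symm ▸ he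
  have hsub : A ⊆ M.conv A \ {e} := fun a ha => ⟨subset_conv A ha, fun h' => heA (h' ▸ ha)⟩
  exact hex.2 (conv_mono hsub he)

/-- The form of the Krein–Milman property needed here: if `A` is acyclic and `c` is not an extreme
point of the hull of `A`, then `c` may be removed from `A` without changing the hull. -/
theorem mem_conv_diff_singleton [Finite E] (hs : M.IsSimple) {A : Set E} (hA : M.IsAcyclicSet A)
    {c : E} (hc : c ∈ M.conv (M.conv A \ {c})) : c ∈ M.conv (A \ {c}) := by
  obtain ⟨G, hG, hGA⟩ := isAcyclicSet_iff.1 hA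
  by_contra hcA
  have hcc : c ∈ M.conv A := (conv_conv A).subset (conv_mono Set.sdiff_subset hc)
  have hGc : G c = 1 := hcc G hG hGA
  -- `A \ {c}` lies strictly on one side of some hyperplane through `c`.
  have hne : {Z | Z ∈ M.covectors ∧ Z c = 0 ∧ ∀ a ∈ A \ {c}, Z a = 1}.Nonempty := by
    simp only [conv, Set.mem_ofPred_eq, not_forall] at hcA
    obtain ⟨F, hF, hFA, hFc⟩ := hcA
    by_cases h0 : F c = 0
    · exact ⟨F, hF, h0, hFA⟩
    obtain ⟨Z, hZ, hZc, hZf⟩ := M.elim F hF G hG c ⟨h0, by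
      rw [hGc]; revert h0 hFc; generalize F c = x; revert x; decide⟩
    refine ⟨Z, hZ, hZc, fun a ha => ?_⟩
    have hFa := hFA a ha
    rw [hZf a (by simp only [signSep, Set.mem_ofPred_eq, hFa, hGA a ha.1]; decide),
      signComp_of_ne_zero (by rw [hFa]; decide), hFa]
  -- Among these hyperplanes, take one containing as few elements as possible.
  obtain ⟨Z, ⟨hZ, hZc, hZA⟩, hmax⟩ :=
    Set.exists_max_image _ (fun Z => {e | Z e ≠ 0}.ncard) (Set.toFinite _) hne
  have hpos : ∀ W ∈ M.covectors, W c = 1 → ∀ y ∈ M.conv A, signComp Z W y = 1 :=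
    fun W hW hWc y hy => hy _ (M.comp_mem Z hZ W hW) fun a ha => by
      by_cases hac : a = c
      · rw [hac, signComp_of_eq_zero hZc, hWc]
      · have := hZA a ⟨ha, hac⟩
        rw [signComp_of_ne_zero (by rw [this]; decide), this]
  have hall : ∀ y ∈ M.conv A \ {c}, Z y = 1 := by
    rintro y ⟨hy, hyc⟩
    by_contra hy1
    have hy0 : Z y = 0 := by
      by_contra h0
      exact hy1 (by rw [← signComp_of_ne_zero (Y := G) h0, hpos G hG hGc y hy])
    have himp : ∀ W ∈ M.covectors, W c = 1 → W y = 1 := fun W hW hWc => by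
      rw [← signComp_of_eq_zero (Y := W) hy0, hpos W hW hWc y hy]
    -- Since `c` and `y` are not parallel, the hyperplane can be tilted around `c` off `y`.
    obtain ⟨X, hX, hXne⟩ := (hs.2 y c hyc).1
    have hXc : X c = 0 ∧ X y ≠ 0 := by
      have h1 := himp X hX
      have h2 := himp _ (M.neg_mem X hX)
      revert hXne h1 h2
      generalize X c = a
      generalize X y = b
      revert a b
      decide
    refine (hmax (signComp Z X) ⟨M.comp_mem Z hZ X hX, ?_, fun a ha => ?_⟩).not_gt
      (Set.ncard_lt_ncard ⟨fun e he => ?_, fun hsub => ?_⟩)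
    · rw [signComp_of_eq_zero hZc, hXc.1]
    · rw [signComp_of_ne_zero (by rw [hZA a ha]; decide), hZA a ha]
    · change signComp Z X e ≠ 0
      rwa [signComp_of_ne_zero he]
    · refine (hsub (?_ : signComp Z X y ≠ 0) : Z y ≠ 0) hy0
      rw [signComp_of_eq_zero hy0]
      exact hXc.2
  have h := hc _ (M.comp_mem Z hZ _ (M.neg_mem G hG)) fun y hy => by
    rw [signComp_of_ne_zero (by rw [hall y hy]; decide), hall y hy]
  rw [signComp_of_eq_zero hZc, hGc] at h
  exact absurd h (by decide)

theorem conv_diff_singleton [Finite E] (hs : M.IsSimple) {A : Set E} (hA : M.IsAcyclicSet A)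
    {c : E} (hc : c ∈ M.conv (M.conv A \ {c})) : M.conv (A \ {c}) = M.conv A := by
  refine (conv_eq_of_subset_of_subset Set.sdiff_subset fun a ha => ?_).symm
  by_cases h : a = c
  · rw [h]; exact mem_conv_diff_singleton hs hA hc
  · exact subset_conv _ ⟨ha, h⟩

end Hull

/-! ### Connectedness -/

section Connected

variable {E : Type*} {M : OrientedMatroid E}

theorem gamma_adj_iff (hc : ¬ M.IsAcyclic) {S T : M.topes} :
    M.gamma.Adj S T ↔ ∀ e, S.1 e = 1 ∨ T.1 e = 1 := by
  refine ⟨fun h e => (h.2.symm ▸ Set.mem_univ e : e ∈ signPos S.1 ∪ signPos T.1), fun h => ⟨?_, ?_⟩⟩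
  · rintro rfl
    exact signPos_ne_univ hc S.2 (Set.eq_univ_of_forall fun e => (h e).elim id id)
  · exact Set.eq_univ_of_forall h

theorem gamma_adj_iff_signNeg_subset (hs : M.IsSimple) (hc : ¬ M.IsAcyclic) {S T : M.topes} :
    M.gamma.Adj S T ↔ signNeg S.1 ⊆ signPos T.1 := by
  rw [gamma_adj_iff hc]
  refine forall_congr' fun e => ?_
  change _ ↔ (S.1 e = -1 → T.1 e = 1)
  rw [eq_neg_one_iff_ne_one_of_mem_topes hs S.2]
  tauto

theorem gamma_reachable_of_signPos_subset (hs : M.IsSimple) (hc : ¬ M.IsAcyclic) {S T : M.topes}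
    (h : signPos S.1 ⊆ signPos T.1) : M.gamma.Reachable S T := by
  -- The opposite of `S` is adjacent to both.
  let N : M.topes := ⟨_, neg_mem_topes hs S.2⟩
  have hSN : M.gamma.Adj S N := (gamma_adj_iff_signNeg_subset hs hc).2 (signPos_neg S.1).ge
  have hTN : M.gamma.Adj T N := (gamma_adj_iff_signNeg_subset hs hc).2 <| by
    rw [show signPos N.1 = signNeg S.1 from signPos_neg S.1, signNeg_eq_compl_signPos hs S.2,
      signNeg_eq_compl_signPos hs T.2]
    exact Set.compl_subset_compl.2 h
  exact hSN.reachable.trans hTN.symm.reachable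

set_option synthInstance.maxSize 512 in
/-- Two elements of a simple oriented matroid are separated by a hyperplane through exactly one of
them. -/
theorem exists_covector_eq_zero_xor (hs : M.IsSimple) {e f : E} (hef : e ≠ f) :
    ∃ W ∈ M.covectors, (W e = 0 ∧ W f ≠ 0) ∨ (W e ≠ 0 ∧ W f = 0) := by
  obtain ⟨⟨X, hX, hXne⟩, Y, hY, hYne⟩ := hs.2 e f hef
  by_contra! hcon
  -- Otherwise every covector vanishes on both elements or on neither. Up to sign, `X` and `Y` then
  -- agree on `f` and are opposite on `e`, and elimination at `e` gives a contradiction.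
  have key : ∀ X ∈ M.covectors, ∀ Y ∈ M.covectors, X f = Y f → X f ≠ 0 →
      X e ≠ -Y e := by
    intro X hX Y hY hf hf0 he
    obtain ⟨Z, hZ, hZe, hZf⟩ := M.elim X hX Y hY e
      ⟨fun h => hf0 ((hcon X hX).1 h), he⟩
    have : Z f = X f := by
      rw [hZf f (fun h => ?_), signComp_of_ne_zero hf0]
      have := h.2
      rw [← hf] at this
      revert hf0 this
      generalize X f = a
      revert a
      decide
    exact hf0 (by rw [← this]; exact (hcon Z hZ).1 hZe)
  have k1 := key X hX Y hY
  have k2 := key X hX _ (M.neg_mem Y hY)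
  have h1 : X e = 0 ↔ X f = 0 := ⟨(hcon X hX).1, not_imp_not.1 (hcon X hX).2⟩
  have h2 : Y e = 0 ↔ Y f = 0 := ⟨(hcon Y hY).1, not_imp_not.1 (hcon Y hY).2⟩
  revert hXne hYne k1 k2 h1 h2
  generalize X e = a
  generalize X f = b
  generalize Y e = c
  generalize Y f = d
  revert a b c d
  decide

variable [Finite E]

/-- Induction on the number of elements where the topes differ: a covector `Y` that interpolates
between them yields intermediate topes `Y ∘ S` and `Y ∘ T`, with fewer differences at each step. -/
theorem gamma_reachable (hs : M.IsSimple) (hc : ¬ M.IsAcyclic) (S T : M.topes) :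
    M.gamma.Reachable S T := by
  induction h : {e | S.1 e ≠ T.1 e}.ncard using Nat.strong_induction_on generalizing S T with
  | _ n ih =>
  by_cases hsub : {e | S.1 e ≠ T.1 e}.Subsingleton
  · -- Topes that differ in at most one element are comparable.
    by_cases hST : signPos S.1 ⊆ signPos T.1
    · exact gamma_reachable_of_signPos_subset hs hc hST
    refine (gamma_reachable_of_signPos_subset hs hc fun g hg => ?_).symm
    obtain ⟨f, hfS, hfT⟩ := Set.not_subset.1 hST
    by_contra hgS
    have hfS' : S.1 f = 1 := hfS
    have hg' : T.1 g = 1 := hg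
    have : f = g := hsub (fun h => hfT (h.symm.trans hfS')) (fun h => hgS (h.trans hg'))
    exact hgS (this ▸ hfS)
  obtain ⟨e, he, f, hf, hef⟩ := Set.not_subsingleton_iff.1 hsub
  have hS0 := (mem_topes_iff hs).1 S.2
  have hT0 := (mem_topes_iff hs).1 T.2
  -- A covector agreeing with both topes where they agree, and vanishing on some but not all of the
  -- elements where they differ.
  obtain ⟨Y, hY, hYoff, ⟨p, hp, hYp⟩, q, hq, hYq⟩ : ∃ Y ∈ M.covectors,
      (∀ g, S.1 g = T.1 g → Y g = S.1 g) ∧ (∃ p, S.1 p ≠ T.1 p ∧ Y p = 0) ∧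
        ∃ q, S.1 q ≠ T.1 q ∧ Y q ≠ 0 := by
    obtain ⟨Z, hZ, hZe, hZoff⟩ := M.elim S.1 hS0.1 T.1 hT0.1 e ⟨hS0.2 e, by
      have h1 := hS0.2 e
      have h2 := hT0.2 e
      revert he h1 h2
      simp only [Set.mem_ofPred_eq]
      generalize S.1 e = a
      generalize T.1 e = b
      revert a b
      decide⟩
    have hZoff' : ∀ g, S.1 g = T.1 g → Z g = S.1 g := fun g hg => by
      rw [hZoff g fun h => ?_, signComp_of_ne_zero (hS0.2 g)]
      have h1 := h.1
      have h2 := h.2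
      rw [← hg] at h2
      revert h1 h2
      generalize S.1 g = a
      revert a
      decide
    by_cases hex : ∃ q, S.1 q ≠ T.1 q ∧ Z q ≠ 0
    · exact ⟨Z, hZ, hZoff', ⟨e, he, hZe⟩, hex⟩
    push Not at hex
    obtain ⟨W, hW, hW'⟩ := exists_covector_eq_zero_xor hs hef
    have hYD : ∀ g, S.1 g ≠ T.1 g → signComp Z W g = W g := fun g hg =>
      signComp_of_eq_zero (hex g hg)
    refine ⟨signComp Z W, M.comp_mem Z hZ W hW, fun g hg => ?_, ?_⟩
    · rw [signComp_of_ne_zero (by rw [hZoff' g hg]; exact hS0.2 g), hZoff' g hg]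
    · rcases hW' with ⟨h1, h2⟩ | ⟨h1, h2⟩
      · exact ⟨⟨e, he, by rwa [hYD e he]⟩, f, hf, by rwa [hYD f hf]⟩
      · exact ⟨⟨f, hf, by rwa [hYD f hf]⟩, e, he, by rwa [hYD e he]⟩
  let S' : M.topes := ⟨_, signComp_mem_topes hs hY S.2⟩
  let T' : M.topes := ⟨_, signComp_mem_topes hs hY T.2⟩
  have step : ∀ U V : M.topes, (∀ g, S.1 g = T.1 g → U.1 g = V.1 g) →
      (∃ r, S.1 r ≠ T.1 r ∧ U.1 r = V.1 r) → M.gamma.Reachable U V := by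
    rintro U V h1 ⟨r, hr, hr'⟩
    refine ih _ ?_ U V rfl
    rw [← h]
    exact Set.ncard_lt_ncard ⟨fun g hg hg' => hg (h1 g hg'), fun hsub' => hsub' hr hr'⟩
  have hSS' : M.gamma.Reachable S S' := step S S'
    (fun g hg => by
      change _ = signComp Y S.1 g
      rw [signComp_of_ne_zero (by rw [hYoff g hg]; exact hS0.2 g), hYoff g hg])
    ⟨p, hp, (signComp_of_eq_zero hYp).symm⟩
  have hST' : M.gamma.Reachable S' T' := step S' T'
    (fun g hg => by
      change signComp Y S.1 g = signComp Y T.1 g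
      rw [signComp, signComp, hg])
    ⟨q, hq, (signComp_of_ne_zero hYq).trans (signComp_of_ne_zero hYq).symm⟩
  have hTT' : M.gamma.Reachable T' T := step T' T
    (fun g hg => by
      change signComp Y T.1 g = _
      rw [signComp_of_ne_zero (by rw [hYoff g hg]; exact hS0.2 g), hYoff g hg, hg])
    ⟨p, hp, signComp_of_eq_zero hYp⟩
  exact hSS'.trans (hST'.trans hTT')

theorem nonempty_topes : M.topes.Nonempty :=
  let ⟨T, hT, _⟩ := exists_tope_extending M.zero_mem
  ⟨T, hT⟩

theorem gamma_connected (hs : M.IsSimple) (hc : ¬ M.IsAcyclic) : M.gamma.Connected :=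
  have := (nonempty_topes (M := M)).to_subtype
  ⟨gamma_reachable hs hc⟩

/-- Replacing each tope by a tope with maximal positive part above it is a retraction of graphs. -/
theorem gammaMax_connected (hs : M.IsSimple) (hc : ¬ M.IsAcyclic) : M.gammaMax.Connected := by
  choose m hm hle using fun T : M.topes => exists_maxTopes_signPos_subset T.2
  let φ : M.gamma →g M.gammaMax :=
    { toFun := fun T => ⟨⟨m T, (hm T).1⟩, hm T⟩
      map_rel' := fun {S T} h => (gamma_adj_iff hc).2 fun e =>
        ((gamma_adj_iff hc).1 h e).imp (fun h => hle S h) (fun h => hle T h) }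
  have hφ : ∀ T, φ T.1 = T := fun T => Subtype.ext <| Subtype.ext <|
    eq_of_signPos_eq hs (hm T.1).1 T.1.2 (T.2.2 _ (hm T.1).1 (hle T.1))
  obtain ⟨T⟩ := (gamma_connected hs hc).nonempty
  have : Nonempty {T : M.topes | (T : E → SignType) ∈ M.maxTopes} := ⟨φ T⟩
  exact ⟨fun U V => by simpa only [hφ] using (gamma_reachable hs hc U.1 V.1).map φ⟩

theorem exists_maxTopes_gamma_adj (hs : M.IsSimple) (hc : ¬ M.IsAcyclic) (S : M.topes) :
    ∃ T : M.topes, (T : E → SignType) ∈ M.maxTopes ∧ M.gamma.Adj S T := by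
  obtain ⟨T, hT, hle⟩ := exists_maxTopes_signPos_subset (neg_mem_topes hs S.2)
  exact ⟨⟨T, hT.1⟩, hT,
    (gamma_adj_iff_signNeg_subset hs hc).2 ((signPos_neg S.1).ge.trans hle)⟩

end Connected

/-! ### Coatoms of the lattice of convex sets -/

section Coatoms

variable {E : Type*} {M : OrientedMatroid E}

theorem signNeg_mem_LHat (hs : M.IsSimple) {T : E → SignType} (hT : T ∈ M.topes) :
    signNeg T ∈ M.LHat :=
  signPos_neg T ▸ Or.inl (isConvex_signPos (neg_mem_topes hs hT))

theorem coe_eq_univ_iff {C : M.LHat} : (C : Set E) = Set.univ ↔ C = ⊤ :=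
  ⟨fun h => Subtype.ext h, fun h => h ▸ rfl⟩

/-- The positive part of a tope, as an element of the lattice of convex sets. -/
def posPart (T : {T : M.topes | (T : E → SignType) ∈ M.maxTopes}) : M.LHat :=
  ⟨signPos T.1.1, Or.inl (isConvex_signPos T.1.2)⟩

/-- The negative part of a tope, as an element of the lattice of convex sets. -/
def negPart (hs : M.IsSimple) (T : {T : M.topes | (T : E → SignType) ∈ M.maxTopes}) : M.LHat :=
  ⟨signNeg T.1.1, signNeg_mem_LHat hs T.1.2⟩

theorem posPart_injective (hs : M.IsSimple) : Function.Injective (posPart (M := M)) :=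
  fun S T h => Subtype.ext <| Subtype.ext <|
    eq_of_signPos_eq hs S.1.2 T.1.2 (congrArg Subtype.val h)

theorem negPart_injective (hs : M.IsSimple) :
    Function.Injective (negPart hs) := by
  intro S T h
  have h' : signNeg S.1.1 = signNeg T.1.1 := congrArg Subtype.val h
  rw [signNeg_eq_compl_signPos hs S.1.2, signNeg_eq_compl_signPos hs T.1.2, compl_inj_iff] at h'
  exact posPart_injective hs (Subtype.ext h')

variable [Finite E]

/-- The coatoms of the lattice of convex sets are the maximal positive parts of topes. -/
theorem range_posPart (hc : ¬ M.IsAcyclic) :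
    Set.range (posPart (M := M)) = M.coatoms := by
  -- A proper convex set lies in the positive part of a tope, hence in a maximal one.
  have key : ∀ C : M.LHat, C ≠ ⊤ →
      ∃ T : {T : M.topes | (T : E → SignType) ∈ M.maxTopes}, C ≤ posPart T := by
    intro C hC
    obtain ⟨hac, -⟩ := C.2.resolve_right fun h => hC (coe_eq_univ_iff.1 h)
    obtain ⟨G, hG, hGC⟩ := isAcyclicSet_iff.1 hac
    obtain ⟨T, hT, hTG⟩ := exists_tope_extending hG
    obtain ⟨T', hT', hle⟩ := exists_maxTopes_signPos_subset hT
    refine ⟨⟨⟨T', hT'.1⟩, hT'⟩, fun a ha => hle ?_⟩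
    have : T a = G a := hTG a (by rw [hGC a ha]; decide)
    exact this.trans (hGC a ha)
  have hne : ∀ T, posPart (M := M) T ≠ ⊤ := fun T h =>
    signPos_ne_univ hc T.1.2 (coe_eq_univ_iff.2 h)
  ext C
  constructor
  · rintro ⟨T, rfl⟩
    refine ⟨hne T, fun B hB => ?_⟩
    by_contra hBtop
    obtain ⟨T', hT'⟩ := key B hBtop
    have : posPart T' = posPart T := Subtype.ext (T.2.2 _ T'.1.2 (hB.le.trans hT'))
    exact (hB.trans_le hT').ne' this
  · intro hC
    obtain ⟨T, hT⟩ := key C hC.1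
    exact ⟨T, (hC.le_iff_eq (hne T)).1 hT⟩

theorem range_negPart (hs : M.IsSimple) (hc : ¬ M.IsAcyclic) :
    Set.range (negPart hs) = M.coatomCompl := by
  ext D
  simp only [coatomCompl, ← range_posPart hc, Set.mem_ofPred_eq, Set.mem_range,
    exists_exists_eq_and]
  refine exists_congr fun T => ?_
  rw [Subtype.ext_iff, show (negPart hs T : Set E) = (posPart T : Set E)ᶜ from
    signNeg_eq_compl_signPos hs T.1.2, compl_eq_comm, eq_comm]

theorem ncard_coatoms (hs : M.IsSimple) (hc : ¬ M.IsAcyclic) :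
    M.coatoms.ncard = Nat.card {T : M.topes | (T : E → SignType) ∈ M.maxTopes} := by
  rw [← range_posPart hc, ← Set.image_univ,
    Set.ncard_image_of_injective _ (posPart_injective hs), Set.ncard_univ]

theorem ncard_neighborSet_gammaMax (hs : M.IsSimple) (hc : ¬ M.IsAcyclic)
    (T : {T : M.topes | (T : E → SignType) ∈ M.maxTopes}) :
    (M.gammaMax.neighborSet T).ncard = (intervalCoatoms (negPart hs T) ⊤).ncard := by
  rw [← Set.ncard_image_of_injective _ (posPart_injective hs)]
  congr 1
  ext C
  simp only [intervalCoatoms, covBy_top_iff, Set.mem_image, Set.mem_ofPred_eq,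
    SimpleGraph.mem_neighborSet, Set.mem_Icc, le_top, and_true]
  constructor
  · rintro ⟨S, hTS, rfl⟩
    exact ⟨(gamma_adj_iff_signNeg_subset hs hc).1 hTS,
      (range_posPart hc).subset (Set.mem_range_self S)⟩
  · rintro ⟨hle, hC⟩
    obtain ⟨S, rfl⟩ := (range_posPart hc).symm.subset hC
    exact ⟨S, (gamma_adj_iff_signNeg_subset hs hc).2 hle, rfl⟩

end Coatoms

/-! ### Counting edges -/

section Counting

theorem sum_ncard_neighborSet {V : Type*} [Fintype V] (G : SimpleGraph V) :
    ∑ v, (G.neighborSet v).ncard = 2 * G.edgeSet.ncard := by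
  classical
  have h := G.sum_degrees_eq_twice_card_edges
  rw [← SimpleGraph.coe_edgeFinset, Set.ncard_coe_finset, ← h]
  exact Finset.sum_congr rfl fun v _ => by
    rw [← SimpleGraph.card_neighborSet_eq_degree, ← Nat.card_eq_fintype_card, Nat.card_coe_set_eq]

theorem cyclomaticNumber_of_connected {V : Type*} {G : SimpleGraph V} (h : G.Connected) :
    cyclomaticNumber G = 1 + (G.edgeSet.ncard : ℤ) - (Nat.card V : ℤ) := by
  have h1 : Nat.card G.ConnectedComponent = 1 := by
    rw [Nat.card_eq_one_iff_unique]
    exact ⟨h.preconnected.subsingleton_connectedComponent,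
      h.nonempty.map G.connectedComponentMk⟩
  rw [cyclomaticNumber, h1]
  push_cast
  ring

open Classical in
theorem sum_subset_neg_one_pow_ncard {E : Type*} [Fintype E] (B : Set E) :
    ∑ A : Set E, (if A ⊆ B then (-1 : ℤ) ^ A.ncard else 0) = if B = ∅ then 1 else 0 := by
  have h := Finset.sum_powerset_neg_one_pow_card (x := B.toFinset)
  simp only [Set.toFinset_eq_empty] at h
  rw [← Fintype.finsetEquivSet.sum_comp, ← h, ← Finset.sum_filter]
  refine Finset.sum_congr ?_ fun A _ => ?_
  · ext A
    rw [Finset.mem_filter]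
    simp [Set.subset_toFinset]
  · simp

variable {E : Type*} {M : OrientedMatroid E}

open Classical in
theorem ncard_posTopes_eq_sum (hs : M.IsSimple) [Fintype M.topes] (A : Set E) :
    ((M.posTopes A).ncard : ℤ) = ∑ T : M.topes, if A ⊆ signNeg T.1 then 1 else 0 := by
  rw [Finset.sum_boole, ← Set.ncard_coe_finset]
  congr 1
  -- Negation carries the topes positive on `A` to the topes negative on `A`.
  refine Set.ncard_congr (fun T hT => ⟨_, neg_mem_topes hs hT.1⟩) (fun T hT => ?_)
    (fun S T _ _ h => ?_) (fun T hT => ?_)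
  · simp only [Finset.coe_filter, Finset.mem_univ, true_and, Set.mem_ofPred_eq]
    exact fun a ha => congrArg Neg.neg (hT.2 a ha)
  · exact funext fun e => neg_injective (congrFun (congrArg Subtype.val h) e)
  · simp only [Finset.coe_filter, Finset.mem_univ, true_and, Set.mem_ofPred_eq] at hT
    refine ⟨fun e => -T.1 e, ⟨neg_mem_topes hs T.2, fun a ha => ?_⟩, Subtype.ext (by simp)⟩
    have : T.1 a = -1 := hT ha
    simp only [this, neg_neg]

/-- Two topes are adjacent when no element is negative on both, so inclusion–exclusion over the sets
of common negative elements counts the edges. -/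
theorem ncard_edgeSet_gamma_eq_sum [Fintype E] (hs : M.IsSimple) (hc : ¬ M.IsAcyclic) :
    (M.gamma.edgeSet.ncard : ℤ) =
      ∑ A : Set E, (-1 : ℤ) ^ A.ncard * (((1 + (M.posTopes A).ncard).choose 2 : ℕ) : ℤ) := by
  classical
  have := Fintype.ofFinite M.topes
  have hchoose : ∀ n : ℕ, 2 * (((1 + n).choose 2 : ℕ) : ℤ) = (n : ℤ) * n + n := fun n => by
    rw [Nat.choose_two_right, Nat.add_sub_cancel_left]
    have h : 2 * ((1 + n) * n / 2) = (1 + n) * n :=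
      Nat.mul_div_cancel' (by simpa [add_comm, mul_comm] using (Nat.even_mul_succ_self n).two_dvd)
    have h' : (2 : ℤ) * (((1 + n) * n / 2 : ℕ) : ℤ) = (1 + n) * n := by exact_mod_cast h
    rw [h']; ring
  have hne : ∀ T : M.topes, signNeg T.1 ≠ ∅ := fun T h => signPos_ne_univ hc T.2 <| by
    rwa [signNeg_eq_compl_signPos hs T.2, Set.compl_empty_iff] at h
  have hlin : ∑ A : Set E, (-1 : ℤ) ^ A.ncard * ((M.posTopes A).ncard : ℤ) = 0 := by
    simp only [ncard_posTopes_eq_sum hs, Finset.mul_sum, mul_ite, mul_one, mul_zero]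
    rw [Finset.sum_comm]
    exact Finset.sum_eq_zero fun T _ => by rw [sum_subset_neg_one_pow_ncard, if_neg (hne T)]
  have hquad : ∑ A : Set E, (-1 : ℤ) ^ A.ncard *
      (((M.posTopes A).ncard : ℤ) * (M.posTopes A).ncard) = 2 * M.gamma.edgeSet.ncard := by
    have hdeg : ∀ S : M.topes, ((M.gamma.neighborSet S).ncard : ℤ) =
        ∑ T : M.topes, if signNeg S.1 ∩ signNeg T.1 = ∅ then 1 else 0 := fun S => by
      rw [Finset.sum_boole, ← Set.ncard_coe_finset]
      congr 2
      ext T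
      rw [SimpleGraph.mem_neighborSet, gamma_adj_iff_signNeg_subset hs hc, Finset.coe_filter,
        Set.mem_ofPred_eq, signNeg_eq_compl_signPos hs T.2, ← Set.disjoint_iff_inter_eq_empty,
        Set.disjoint_compl_right_iff_subset]
      simp
    have hsq : ∀ A : Set E, (-1 : ℤ) ^ A.ncard *
        (((M.posTopes A).ncard : ℤ) * (M.posTopes A).ncard) = ∑ S : M.topes, ∑ T : M.topes,
          if A ⊆ signNeg S.1 ∩ signNeg T.1 then (-1 : ℤ) ^ A.ncard else 0 := fun A => by
      rw [ncard_posTopes_eq_sum hs, Finset.sum_mul_sum]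
      simp only [Finset.mul_sum, Set.subset_inter_iff, ite_and, mul_ite, mul_one, mul_zero]
      exact Finset.sum_comm
    have hsum : (∑ S, ((M.gamma.neighborSet S).ncard : ℤ)) = 2 * M.gamma.edgeSet.ncard := by
      exact_mod_cast sum_ncard_neighborSet M.gamma
    simp only [hsq, ← hsum, hdeg]
    rw [Finset.sum_comm]
    refine Finset.sum_congr rfl fun S _ => ?_
    rw [Finset.sum_comm]
    exact Finset.sum_congr rfl fun T _ => sum_subset_neg_one_pow_ncard _
  have h2 : (2 : ℤ) * M.gamma.edgeSet.ncard = 2 * ∑ A : Set E, (-1 : ℤ) ^ A.ncard *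
      (((1 + (M.posTopes A).ncard).choose 2 : ℕ) : ℤ) := by
    rw [Finset.mul_sum, ← hquad, ← add_zero (Finset.sum _ _), ← hlin, ← Finset.sum_add_distrib]
    exact Finset.sum_congr rfl fun A _ => by
      rw [← mul_add, ← hchoose, mul_left_comm]
  linarith

theorem ncard_posTopes_of_not_isAcyclicSet {A : Set E} (hA : ¬ M.IsAcyclicSet A) :
    (M.posTopes A).ncard = 0 := by
  rw [Set.eq_empty_of_forall_notMem (s := M.posTopes A) fun T hT =>
    hA (isAcyclicSet_iff.2 ⟨T, hT.1.1, hT.2⟩), Set.ncard_empty]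

variable [Finite E]

theorem conv_symmDiff_singleton (hs : M.IsSimple) {A : Set E} (hA : M.IsAcyclicSet A) {c : E}
    (hc : c ∈ M.conv (M.conv A \ {c})) : M.conv (symmDiff A {c}) = M.conv A := by
  by_cases h : c ∈ A
  · rw [symmDiff_of_ge (Set.singleton_subset_iff.2 h), conv_diff_singleton hs hA hc]
  · rw [(Set.disjoint_singleton_right.2 h).symmDiff_eq_sup]
    refine conv_eq_of_subset_of_subset Set.subset_union_left
      (Set.union_subset (subset_conv A) (Set.singleton_subset_iff.2 ?_))
    exact (conv_conv A).subset (conv_mono Set.sdiff_subset hc)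

theorem neg_one_pow_ncard_symmDiff_singleton (A : Set E) (c : E) :
    (-1 : ℤ) ^ (symmDiff A {c}).ncard = -(-1) ^ A.ncard := by
  by_cases h : c ∈ A
  · rw [symmDiff_of_ge (Set.singleton_subset_iff.2 h), ← Set.ncard_sdiff_singleton_add_one h]
    ring_nf
  · rw [(Set.disjoint_singleton_right.2 h).symmDiff_eq_sup, show A ⊔ {c} = A ∪ {c} from rfl,
      Set.union_singleton,
      Set.ncard_insert_of_notMem h]
    ring

open Classical in
/-- In an alternating sum whose terms depend only on hulls, the contributions of the sets with a
given hull that is not free cancel: a nonextreme point of the hull can be added or removed. -/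
theorem sum_not_isFree_eq_zero [Fintype E] [Nonempty E] (hs : M.IsSimple) (g : Set E → ℤ)
    (hg : ∀ A, g (M.conv A) = g A) (hg0 : ∀ A, ¬ M.IsAcyclicSet A → g A = 0) :
    ∑ A : Set E with ¬ M.IsFree A, (-1 : ℤ) ^ A.ncard * g A = 0 := by
  have hex : ∀ C : Set E, M.IsConvex C → ¬ M.IsFree C → ∃ c, c ∈ M.conv (C \ {c}) := by
    intro C hC hfree
    by_contra! hcon
    exact hfree ⟨hC, Set.Subset.antisymm (fun c hc => hc.1) fun c hc => ⟨hc, hcon c⟩⟩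
  choose! c hc using hex
  -- The point `c (conv A)` depends on the hull only, so adding or removing it is an involution.
  have hcA : ∀ A, M.IsAcyclicSet A → ¬ M.IsFree A →
      c (M.conv A) ∈ M.conv (M.conv A \ {c (M.conv A)}) := fun A hA hfree =>
    hc _ (isConvex_conv hA) fun h => hfree (eq_conv_of_isFree_conv h ▸ h)
  have hcancel : ∑ A : Set E with M.IsAcyclicSet A ∧ ¬ M.IsFree A,
      (-1 : ℤ) ^ A.ncard * g A = 0 := by
    refine Finset.sum_involution (fun A _ => symmDiff A {c (M.conv A)}) (fun A hA => ?_)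
      (fun A _ _ h => ?_) (fun A hA => ?_) (fun A hA => ?_)
    · obtain ⟨hac, hfree⟩ := (Finset.mem_filter.1 hA).2
      rw [← hg (symmDiff _ _), conv_symmDiff_singleton hs hac (hcA A hac hfree), hg,
        neg_one_pow_ncard_symmDiff_singleton]
      ring
    · rw [symmDiff_eq_left] at h
      exact Set.singleton_ne_empty _ h
    · obtain ⟨hac, hfree⟩ := (Finset.mem_filter.1 hA).2
      have hconv := conv_symmDiff_singleton hs hac (hcA A hac hfree)
      refine Finset.mem_filter.2 ⟨Finset.mem_univ _, ?_, fun h => ?_⟩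
      · rwa [← isAcyclicSet_conv, hconv, isAcyclicSet_conv]
      · have hA' : M.IsFree (M.conv A) := by rwa [← hconv, h.1.2]
        exact hfree (eq_conv_of_isFree_conv hA' ▸ hA')
    · obtain ⟨hac, hfree⟩ := (Finset.mem_filter.1 hA).2
      simp only [conv_symmDiff_singleton hs hac (hcA A hac hfree), symmDiff_symmDiff_cancel_right]
  rw [← hcancel]
  refine (Finset.sum_subset (fun A hA => ?_) fun A hA hA' => ?_).symm
  · exact Finset.mem_filter.2 ⟨Finset.mem_univ _, (Finset.mem_filter.1 hA).2.2⟩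
  · rw [hg0 A fun h => hA' ?_, mul_zero]
    exact Finset.mem_filter.2 ⟨Finset.mem_univ _, h, (Finset.mem_filter.1 hA).2⟩

theorem ncard_edgeSet_gamma (hs : M.IsSimple) (hc : ¬ M.IsAcyclic) :
    (M.gamma.edgeSet.ncard : ℤ) = ((1 + M.topes.ncard).choose 2 : ℕ) +
      ∑ᶠ (A : Set E) (_ : A ∈ M.properFreeSets),
        (-1 : ℤ) ^ A.ncard * (((1 + (M.posTopes A).ncard).choose 2 : ℕ) : ℤ) := by
  classical
  have := Fintype.ofFinite E
  have : Nonempty E := by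
    by_contra h
    rw [not_nonempty_iff] at h
    have h01 : (fun _ : E => (0 : SignType)) = fun _ => 1 := Subsingleton.elim _ _
    exact hc (h01 ▸ M.zero_mem : (fun _ => 1) ∈ M.covectors)
  have h0 : M.posTopes ∅ = M.topes := by ext T; simp [posTopes]
  have hfree : Finset.univ.filter (fun A => M.IsFree A) = insert ∅ M.properFreeSets.toFinset := by
    ext A
    simp only [Finset.mem_filter, Finset.mem_univ, true_and, Finset.mem_insert, Set.mem_toFinset]
    constructor
    · intro h
      refine or_iff_not_imp_left.2 fun hA => ⟨Or.inl h.1, hA, ?_, h⟩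
      rintro rfl
      exact not_isAcyclicSet_univ hc h.1.1
    · rintro (rfl | h)
      · exact isFree_empty
      · exact h.2.2.2
  have hzero := sum_not_isFree_eq_zero hs
    (fun A => (((1 + (M.posTopes A).ncard).choose 2 : ℕ) : ℤ))
    (fun A => by rw [posTopes_conv])
    (fun A hA => by rw [ncard_posTopes_of_not_isAcyclicSet hA]; rfl)
  rw [ncard_edgeSet_gamma_eq_sum hs hc,
    ← Finset.sum_filter_add_sum_filter_not _ (fun A => M.IsFree A), hzero, add_zero, hfree,
    Finset.sum_insert fun h => (Set.mem_toFinset.1 h).2.1 rfl, h0, Set.ncard_empty, pow_zero,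
    one_mul, finsum_mem_eq_toFinset_sum]

theorem ncard_edgeSet_gammaMax (hs : M.IsSimple) (hc : ¬ M.IsAcyclic) :
    (M.gammaMax.edgeSet.ncard : ℚ) = 1 / 2 *
      (∑ᶠ (D : M.LHat) (_ : D ∈ M.coatomCompl), ((intervalCoatoms D ⊤).ncard : ℚ)) := by
  have := Fintype.ofFinite {T : M.topes | (T : E → SignType) ∈ M.maxTopes}
  have h : (∑ T, ((M.gammaMax.neighborSet T).ncard : ℚ)) = 2 * M.gammaMax.edgeSet.ncard := by
    exact_mod_cast sum_ncard_neighborSet M.gammaMax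
  rw [← range_negPart hs hc, finsum_mem_range (negPart_injective hs),
    finsum_eq_sum_of_fintype]
  simp only [← ncard_neighborSet_gammaMax hs hc, h]
  ring

end Counting

end OrientedMatroid

theorem mainTheorem4 {E : Type*} [Finite E] (M : OrientedMatroid E)
    (hsimple : M.IsSimple) (hcyc : ¬ M.IsAcyclic) :
    -- the graph of topes with maximal positive parts is connected
    M.gammaMax.Connected ∧
    -- every other tope has a neighbour among them
    (∀ S : M.topes, (S : E → SignType) ∉ M.maxTopes →
      ∃ T : M.topes, (T : E → SignType) ∈ M.maxTopes ∧ M.gamma.Adj S T) ∧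
    -- the graph of all topes is connected, and its cyclomatic number
    M.gamma.Connected ∧
    cyclomaticNumber M.gamma =
      1 + ((M.topes.ncard.choose 2 : ℕ) : ℤ) +
        ∑ᶠ (A : Set E) (_ : A ∈ M.properFreeSets),
          (-1 : ℤ) ^ A.ncard * (((1 + (M.posTopes A).ncard).choose 2 : ℕ) : ℤ) ∧
    -- vertex degrees, number of edges and cyclomatic number of the maximal graph
    (∀ T : {T : M.topes | (T : E → SignType) ∈ M.maxTopes},
      ∃ hT : signNeg (T.1 : E → SignType) ∈ M.LHat,
        (M.gammaMax.neighborSet T).ncard =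
          (intervalCoatoms (⟨signNeg (T.1 : E → SignType), hT⟩ : M.LHat) ⊤).ncard) ∧
    (M.gammaMax.edgeSet.ncard : ℚ) =
      1 / 2 * (∑ᶠ (D : M.LHat) (_ : D ∈ M.coatomCompl), ((intervalCoatoms D ⊤).ncard : ℚ)) ∧
    (cyclomaticNumber M.gammaMax : ℚ) =
      1 + 1 / 2 * (∑ᶠ (D : M.LHat) (_ : D ∈ M.coatomCompl), ((intervalCoatoms D ⊤).ncard : ℚ))
        - (M.coatoms.ncard : ℚ) := by
  have hγ := OrientedMatroid.gamma_connected hsimple hcyc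
  have hmax := OrientedMatroid.gammaMax_connected hsimple hcyc
  refine ⟨hmax, fun S _ => OrientedMatroid.exists_maxTopes_gamma_adj hsimple hcyc S, hγ, ?_,
    fun T => ⟨OrientedMatroid.signNeg_mem_LHat hsimple T.1.2,
      OrientedMatroid.ncard_neighborSet_gammaMax hsimple hcyc T⟩,
    OrientedMatroid.ncard_edgeSet_gammaMax hsimple hcyc, ?_⟩
  · rw [OrientedMatroid.cyclomaticNumber_of_connected hγ,
      OrientedMatroid.ncard_edgeSet_gamma hsimple hcyc, Nat.card_coe_set_eq,
      add_comm 1 M.topes.ncard, Nat.choose_succ_succ' _ 1, Nat.choose_one_right]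
    push_cast
    ring
  · rw [OrientedMatroid.cyclomaticNumber_of_connected hmax,
      OrientedMatroid.ncard_coatoms hsimple hcyc,
      ← OrientedMatroid.ncard_edgeSet_gammaMax hsimple hcyc]
    push_cast
    rfl
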